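/- Let $n \ge 1$, let $M$ be a closed (compact, without boundary, not necessarily connected) smooth $n$-dimensional manifold with a volume form $\Omega$ (a smooth, nowhere vanishing $n$-form), and let $\varepsilon \ge 0$. For $F_1,\dots,F_n \in C^\infty(M)$ let the bracket $\{F_1,\dots,F_n\} \in C^\infty(M)$ be the function defined by $\{F_1,\dots,F_n\}\,\Omega = dF_1\wedge\dots\wedge dF_n$; let $\|F\| = \sup_{M}|F|$ denote the uniform norm and $\|F\|_{L^1} = \int_M |F|\,\Omega$ the $L^1$ norm, where $M$ carries the orientation given by $\Omega$. If $F_1,\dots,F_n \in C^\infty(M)$ satisfy $$\|\{F_1,\dots,F_n\}\|_{L^1} \le 2\varepsilon,$$ then there are $F_1',\dots,F_n' \in C^\infty(M)$ with $\|F_i - F_i'\| \le \varepsilon^{1/n}$ for all $i = 1,\dots,n$ and $\{F_1',\dots,F_n'\} \equiv 0$. -/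

import Mathlib

open MeasureTheory
open scoped Manifold ContDiff ENNReal

noncomputable section

section

variable (n : ℕ) (M : Type*) [TopologicalSpace M] [ChartedSpace (EuclideanSpace ℝ (Fin n)) M]

/-- The coefficient of an `n`-form `η` in a chart `e` of the `n`-manifold `M`: the function `ρ` on
`e.target ⊆ ℝⁿ` for which `(e⁻¹)^* η = ρ dx₁ ∧ … ∧ dxₙ`, that is
`ρ y = η (∂/∂x₁, …, ∂/∂xₙ)` at the point `e⁻¹ y`. (Values outside `e.target` are meaningless and
never used.) -/
def formCoeff {n : ℕ} {M : Type*} [TopologicalSpace M] [ChartedSpace (EuclideanSpace ℝ (Fin n)) M]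
    (η : ∀ x : M, TangentSpace (𝓡 n) x [⋀^Fin n]→ₗ[ℝ] ℝ)
    (e : OpenPartialHomeomorph M (EuclideanSpace ℝ (Fin n))) (y : EuclideanSpace ℝ (Fin n)) : ℝ :=
  η (e.symm y) fun i => mfderiv (𝓡 n) (𝓡 n) e.symm y (EuclideanSpace.basisFun (Fin n) ℝ i)

/-- A volume form on the `n`-manifold `M`: a smooth, nowhere vanishing differential `n`-form.
Smoothness means that the coefficient in every chart is smooth. -/
structure VolumeForm where
  /-- The value of the form at a point. -/
  toFun : ∀ x : M, TangentSpace (𝓡 n) x [⋀^Fin n]→ₗ[ℝ] ℝ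
  smooth' : ∀ e ∈ IsManifold.maximalAtlas (𝓡 n) ∞ M, ContDiffOn ℝ ∞ (formCoeff toFun e) e.target
  ne_zero' : ∀ x, toFun x ≠ 0

end

section

variable {n : ℕ} {M : Type*} [TopologicalSpace M] [ChartedSpace (EuclideanSpace ℝ (Fin n)) M]

/-- The `n`-form `dF₁ ∧ … ∧ dFₙ`, given by
`(dF₁ ∧ … ∧ dFₙ) (v₁, …, vₙ) = det (dFᵢ (vⱼ))`. -/
def wedgeDiff (F : Fin n → M → ℝ) (x : M) : TangentSpace (𝓡 n) x [⋀^Fin n]→ₗ[ℝ] ℝ :=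
  (Matrix.detRowAlternating (n := Fin n) (R := ℝ)).compLinearMap
    (LinearMap.pi fun i => (mvfderiv (𝓡 n) (F i) x).toLinearMap)

theorem wedgeDiff_apply (F : Fin n → M → ℝ) (x : M) (v : Fin n → TangentSpace (𝓡 n) x) :
    wedgeDiff F x v = Matrix.det (Matrix.of fun i j => mvfderiv (𝓡 n) (F i) x (v j)) := by
  rw [← Matrix.det_transpose]
  rfl

/-- The standard basis of the tangent space (which is, by definition, the model space `ℝⁿ`). -/
def tangentBasis (x : M) : Module.Basis (Fin n) ℝ (TangentSpace (𝓡 n) x) :=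
  (EuclideanSpace.basisFun (Fin n) ℝ).toBasis

namespace VolumeForm

theorem apply_tangentBasis_ne_zero (Ω : VolumeForm n M) (x : M) :
    Ω.toFun x (tangentBasis x) ≠ 0 :=
  (AlternatingMap.map_basis_ne_zero_iff (tangentBasis x) (Ω.toFun x)).2 (Ω.ne_zero' x)

/-- The bracket `{F₁, …, Fₙ}`: the function with `{F₁, …, Fₙ} Ω = dF₁ ∧ … ∧ dFₙ`
(see `bracket_eq_iff`). -/
def bracket (Ω : VolumeForm n M) (F : Fin n → M → ℝ) (x : M) : ℝ :=
  wedgeDiff F x (tangentBasis x) / Ω.toFun x (tangentBasis x)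

/-- The bracket is characterised by `{F₁, …, Fₙ} Ω = dF₁ ∧ … ∧ dFₙ`. -/
theorem bracket_eq_iff (Ω : VolumeForm n M) (F : Fin n → M → ℝ) (g : M → ℝ) :
    Ω.bracket F = g ↔ ∀ x, g x • Ω.toFun x = wedgeDiff F x := by
  have key : ∀ x, Ω.bracket F x • Ω.toFun x = wedgeDiff F x := by
    intro x
    rw [(Ω.toFun x).eq_smul_basis_det (tangentBasis x), smul_smul, bracket,
      div_mul_cancel₀ _ (Ω.apply_tangentBasis_ne_zero x)]
    exact ((wedgeDiff F x).eq_smul_basis_det (tangentBasis x)).symm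
  constructor
  · rintro rfl
    exact key
  · intro h
    funext x
    have h3 := congrArg (fun η => η (tangentBasis x)) ((key x).trans (h x).symm)
    exact mul_right_cancel₀ (Ω.apply_tangentBasis_ne_zero x) h3

/-- The density `|ρ| dx₁ … dxₙ` of a volume form on the domain of the chart `e`, as a measure on `M`
concentrated on `e.source`. -/
def chartMeasure [MeasurableSpace M] (Ω : VolumeForm n M)
    (e : OpenPartialHomeomorph M (EuclideanSpace ℝ (Fin n))) : Measure M :=
  ((volume.restrict e.target).withDensity fun y => ‖formCoeff Ω.toFun e y‖ₑ).map e.symm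

/-- The measure of a volume form on a (second countable) manifold, `s ↦ ∫_s |Ω|`, so that the
integral of `f Ω` for the orientation given by `Ω` is the integral of `f` for this measure.
It is the smallest measure that dominates the densities of `Ω` in all charts (these densities agree
on overlaps, and the measure restricts to each of them on the domain of the chart, see
`measure_apply_of_subset`). -/
def measure [MeasurableSpace M] (Ω : VolumeForm n M) : Measure M :=
  ⨆ e ∈ IsManifold.maximalAtlas (𝓡 n) ∞ M, Ω.chartMeasure e

/-- The `L¹` norm `∫_M |f| Ω`. -/
def normL1 [MeasurableSpace M] (Ω : VolumeForm n M) (f : M → ℝ) : ℝ≥0∞ :=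
  ∫⁻ x, ‖f x‖ₑ ∂Ω.measure

section

open Set Filter Topology

theorem chartMeasure_apply [MeasurableSpace M] [BorelSpace M] (Ω : VolumeForm n M)
    (e : OpenPartialHomeomorph M (EuclideanSpace ℝ (Fin n))) {s : Set M} (hs : MeasurableSet s) :
    Ω.chartMeasure e s = ∫⁻ y in e.target ∩ e.symm ⁻¹' s, ‖formCoeff Ω.toFun e y‖ₑ := by
  have h1 : AEMeasurable e.symm ((volume.restrict e.target).withDensity
      fun y => ‖formCoeff Ω.toFun e y‖ₑ) :=
    (e.continuousOn_symm.aemeasurable e.open_target.measurableSet).mono_ac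
      (withDensity_absolutelyContinuous _ _)
  rw [chartMeasure, Measure.map_apply_of_aemeasurable h1 hs, withDensity_apply',
    Measure.restrict_restrict' e.open_target.measurableSet, inter_comm]

theorem coeff_congr (Ω : VolumeForm n M) {φ ψ : EuclideanSpace ℝ (Fin n) → M}
    {y : EuclideanSpace ℝ (Fin n)} (h : φ =ᶠ[𝓝 y] ψ) :
    Ω.toFun (φ y) (fun i => mfderiv (𝓡 n) (𝓡 n) φ y (EuclideanSpace.basisFun (Fin n) ℝ i)) =
    Ω.toFun (ψ y) (fun i => mfderiv (𝓡 n) (𝓡 n) ψ y (EuclideanSpace.basisFun (Fin n) ℝ i)) := by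
  have h1 := h.mfderiv_eq (I := 𝓡 n) (I' := 𝓡 n)
  have h2 := h.eq_of_nhds
  have key : ∀ (p q : M) (hpq : p = q)
    (A : EuclideanSpace ℝ (Fin n) →L[ℝ] EuclideanSpace ℝ (Fin n)),
    Ω.toFun p (fun i => (A (EuclideanSpace.basisFun (Fin n) ℝ i) : EuclideanSpace ℝ (Fin n))) =
    Ω.toFun q (fun i => (A (EuclideanSpace.basisFun (Fin n) ℝ i) : EuclideanSpace ℝ (Fin n))) := by
    rintro p q rfl A; rfl
  have h3 := key _ _ h2 (mfderiv (𝓡 n) (𝓡 n) φ y)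
  refine h3.trans ?_
  have h4 : (mfderiv (𝓡 n) (𝓡 n) φ y : EuclideanSpace ℝ (Fin n) →L[ℝ] EuclideanSpace ℝ (Fin n)) =
    (mfderiv (𝓡 n) (𝓡 n) ψ y : EuclideanSpace ℝ (Fin n) →L[ℝ] EuclideanSpace ℝ (Fin n)) := h1
  rw [h4]
  rfl

/-- The coefficients in two charts differ by the Jacobian determinant of the transition map. -/
theorem formCoeff_change [IsManifold (𝓡 n) ∞ M] (Ω : VolumeForm n M)
    {e e' : OpenPartialHomeomorph M (EuclideanSpace ℝ (Fin n))}
    (he : e ∈ IsManifold.maximalAtlas (𝓡 n) ∞ M) (he' : e' ∈ IsManifold.maximalAtlas (𝓡 n) ∞ M)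
    {y : EuclideanSpace ℝ (Fin n)} (hy : y ∈ e'.target) (hy2 : e'.symm y ∈ e.source) :
    DifferentiableAt ℝ (e ∘ e'.symm) y ∧ formCoeff Ω.toFun e' y =
      (fderiv ℝ (e ∘ e'.symm) y).det * formCoeff Ω.toFun e ((e ∘ e'.symm) y) := by
  have a1 : MDifferentiableAt (𝓡 n) (𝓡 n) e'.symm y :=
    (contMDiffAt_symm_of_mem_maximalAtlas he' hy).mdifferentiableAt (by simp)
  have a2 : MDifferentiableAt (𝓡 n) (𝓡 n) e (e'.symm y) :=
    (contMDiffAt_of_mem_maximalAtlas he hy2).mdifferentiableAt (by simp)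
  have a3 : MDifferentiableAt (𝓡 n) (𝓡 n) (e ∘ e'.symm) y := a2.comp y a1
  have a4 : DifferentiableAt ℝ (e ∘ e'.symm) y := a3.differentiableAt
  have a5 : MDifferentiableAt (𝓡 n) (𝓡 n) e.symm ((e ∘ e'.symm) y) :=
    (contMDiffAt_symm_of_mem_maximalAtlas he (e.map_source hy2)).mdifferentiableAt (by simp)
  refine ⟨a4, ?_⟩
  have ev : (e'.symm : EuclideanSpace ℝ (Fin n) → M) =ᶠ[𝓝 y] e.symm ∘ (e ∘ e'.symm) := by
    have : e'.target ∩ e'.symm ⁻¹' e.source ∈ 𝓝 y :=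
      (e'.isOpen_inter_preimage_symm e.open_source).mem_nhds ⟨hy, hy2⟩
    filter_upwards [this] with z hz
    exact (e.left_inv hz.2).symm
  have b := Ω.coeff_congr ev
  unfold formCoeff
  refine b.trans ?_
  set p := (e ∘ e'.symm) y with hp
  rw [mfderiv_comp y a5 a3, mfderiv_eq_fderiv]
  let L : EuclideanSpace ℝ (Fin n) →ₗ[ℝ] TangentSpace (𝓡 n) (e.symm p) :=
    (mfderiv (𝓡 n) (𝓡 n) e.symm p).toLinearMap
  let A : (EuclideanSpace ℝ (Fin n)) [⋀^Fin n]→ₗ[ℝ] ℝ := (Ω.toFun (e.symm p)).compLinearMap L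
  let bs := (EuclideanSpace.basisFun (Fin n) ℝ).toBasis
  have c := A.eq_smul_basis_det bs
  let T := (fderiv ℝ (e ∘ e'.symm) y).toLinearMap
  have d : A (T ∘ bs) = LinearMap.det T * A bs := by
    conv_lhs => rw [c]
    rw [AlternatingMap.smul_apply, Module.Basis.det_comp, Module.Basis.det_self, mul_one, smul_eq_mul,
      mul_comm]
  have e1 : (bs : Fin n → EuclideanSpace ℝ (Fin n)) = fun i => EuclideanSpace.basisFun (Fin n) ℝ i := by
    ext1 i; simp [bs]
  rw [e1] at d
  exact d

/-- The densities in two charts agree on the overlap. -/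
theorem chartMeasure_eq_chartMeasure [IsManifold (𝓡 n) ∞ M] [MeasurableSpace M] [BorelSpace M] (Ω : VolumeForm n M)
    {e e' : OpenPartialHomeomorph M (EuclideanSpace ℝ (Fin n))}
    (he : e ∈ IsManifold.maximalAtlas (𝓡 n) ∞ M) (he' : e' ∈ IsManifold.maximalAtlas (𝓡 n) ∞ M)
    {s : Set M} (hs : MeasurableSet s) (h : s ⊆ e.source) (h' : s ⊆ e'.source) :
    Ω.chartMeasure e s = Ω.chartMeasure e' s := by
  rw [chartMeasure_apply _ _ hs, chartMeasure_apply _ _ hs]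
  have hT : MeasurableSet (e'.target ∩ e'.symm ⁻¹' s) := by
    have h1 : Measurable fun z : e'.target => e'.symm z :=
      (continuousOn_iff_continuous_domRestrict.1 e'.continuousOn_symm).measurable
    have := e'.open_target.measurableSet.subtype_image (h1 hs)
    rwa [show (Subtype.val '' ((fun z : e'.target => e'.symm z) ⁻¹' s)) =
      e'.target ∩ e'.symm ⁻¹' s from Subtype.image_preimage_coe e'.target (e'.symm ⁻¹' s)] at this
  have im : e.target ∩ e.symm ⁻¹' s = (e ∘ e'.symm) '' (e'.target ∩ e'.symm ⁻¹' s) := by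
    ext z; constructor
    · rintro ⟨hz, hz2⟩
      refine ⟨e' (e.symm z), ⟨e'.map_source (h' hz2), ?_⟩, ?_⟩
      · simpa [e'.left_inv (h' hz2)] using hz2
      · simp [e'.left_inv (h' hz2), e.right_inv hz]
    · rintro ⟨w, ⟨hw, hw2⟩, rfl⟩
      refine ⟨e.map_source (h hw2), ?_⟩
      simpa [e.left_inv (h hw2)] using hw2
  have inj : InjOn (e ∘ e'.symm) (e'.target ∩ e'.symm ⁻¹' s) := by
    rintro w ⟨hw, hw2⟩ z ⟨hz, hz2⟩ hwz
    exact e'.symm.injOn hw hz (e.injOn (h hw2) (h hz2) hwz)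
  rw [im, lintegral_image_eq_lintegral_abs_det_fderiv_mul volume hT
    (fun y hy => ((Ω.formCoeff_change he he' hy.1 (h hy.2)).1.hasFDerivAt).hasFDerivWithinAt) inj]
  refine setLIntegral_congr_fun hT fun y hy => ?_
  rw [(Ω.formCoeff_change he he' hy.1 (h hy.2)).2, enorm_mul, Real.enorm_eq_ofReal_abs, Real.enorm_eq_ofReal_abs]

/-- On the domain of a chart, the measure of `Ω` is the density of `Ω` in that chart. -/
theorem measure_apply_of_subset [IsManifold (𝓡 n) ∞ M] [MeasurableSpace M] [BorelSpace M]
    (Ω : VolumeForm n M)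
    {e : OpenPartialHomeomorph M (EuclideanSpace ℝ (Fin n))}
    (he : e ∈ IsManifold.maximalAtlas (𝓡 n) ∞ M)
    {s : Set M} (hs : MeasurableSet s) (h : s ⊆ e.source) :
    Ω.measure s = Ω.chartMeasure e s := by
  refine le_antisymm ?_ (Measure.le_iff.1
    (le_iSup₂_of_le (f := fun e _ => Ω.chartMeasure e) e he le_rfl) s hs)
  have hes := e.open_source.measurableSet
  let ν : Measure M := Ω.chartMeasure e + (⊤ : ℝ≥0∞) • Measure.count.restrict e.sourceᶜ
  have hν : Ω.measure ≤ ν := by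
    refine iSup₂_le fun e' he' => Measure.le_iff.2 fun t ht => ?_
    by_cases hte : t ⊆ e.source
    · have h0 : Ω.chartMeasure e' (t \ e'.source) = 0 := by
        rw [chartMeasure_apply _ _ (ht.diff e'.open_source.measurableSet),
          show e'.target ∩ e'.symm ⁻¹' (t \ e'.source) = ∅ by
            ext z; simp only [mem_inter_iff, mem_preimage, Set.mem_sdiff, mem_empty_iff_false, iff_false]
            exact fun hz => hz.2.2 (e'.map_target hz.1)]
        simp
      rw [← measure_inter_add_sdiff t e'.open_source.measurableSet, h0, add_zero,
        ← Ω.chartMeasure_eq_chartMeasure he he' (ht.inter e'.open_source.measurableSet) (inter_subset_left.trans hte)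
          inter_subset_right]
      exact (measure_mono inter_subset_left).trans (Measure.le_iff.1 (Measure.le_add_right le_rfl) t ht)
    · have : ν t = ⊤ := by
        obtain ⟨x, hx, hxe⟩ := not_subset.1 hte
        simp only [ν, Measure.add_apply, Measure.smul_apply, Measure.restrict_apply ht, smul_eq_mul]
        rw [ENNReal.top_mul (Measure.count_ne_zero (s := t ∩ e.sourceᶜ) ⟨x, hx, hxe⟩), add_top]
      rw [this]; exact le_top
  refine (Measure.le_iff.1 hν s hs).trans ?_
  simp only [ν, Measure.add_apply, Measure.smul_apply, Measure.restrict_apply hs, smul_eq_mul]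
  rw [show s ∩ e.sourceᶜ = ∅ from by exact sdiff_eq_empty.2 h]
  simp

end

end VolumeForm

end

/-- The uniform norm `sup |f|` of a real function. -/
def uniformNorm {X : Type*} (f : X → ℝ) : ℝ≥0∞ :=
  ⨆ x, ‖f x‖ₑ

end

/-! The L¹ norm of the bracket is the integral over `M` of the absolute Jacobian of `F = (F₁, …, Fₙ)
: M → ℝⁿ`, so it bounds the volume of the compact image `F(M)`, which is therefore at most `2ε`
(`volume_range_le_normL1_bracket`).

For `n ≥ 2` and `ε > 0` put `L = 2ε^(1/n)`. A cube of side `L` has volume `2ⁿε > 2ε`, so by a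
pigeonhole argument some translate of the lattice `Lℤⁿ` misses `F(M)`, and by compactness it does so
uniformly. Compose each `Fᵢ` with a staircase of step `L` that is flat except near the `i`-th
coordinates of that lattice. At every point of `M` some `Fᵢ` lies over a flat piece, so one row of
the Jacobian vanishes. The staircase is within `L / 2 = ε^(1/n)` of the identity.

Two cases lack the strict inequality. For `n = 1`, the image of each connected component is an
interval of length at most `2ε`, and `F` is replaced there by its midpoint. For `n ≥ 2` and `ε = 0`
the image is null, so the bracket already vanishes, since a nonzero Jacobian would make the image
contain an open set. -/

section

open Filter Topology
open scoped Pointwise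

/-! ### Smooth staircases. -/

/-- A smooth staircase with steps of height `1`, rising only within distance `r` of the integers. -/
noncomputable def smoothStaircase (r t : ℝ) : ℝ :=
  round t + (Real.smoothTransition ((t - round t + r) / (2 * r)) - 1 / 2)

theorem smoothStaircase_eq {r t : ℝ} (hr : 0 < r) {m : ℤ} (h1 : m + r ≤ t) (h2 : t ≤ m + 1 - r) :
    smoothStaircase r t = m + 1 / 2 := by
  have ha := abs_le.1 (abs_sub_round t)
  have hm1 : m ≤ round t := by
    have : (m : ℝ) < round t + 1 := by linarith [ha.2]
    exact Int.lt_add_one_iff.1 (by exact_mod_cast this)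
  have hm2 : round t ≤ m + 1 := by
    have : (round t : ℝ) < m + 1 + 1 := by linarith [ha.1]
    exact Int.lt_add_one_iff.1 (by exact_mod_cast this)
  unfold smoothStaircase
  obtain h | h : round t = m ∨ round t = m + 1 := by omega
  · rw [h, Real.smoothTransition.one_of_one_le]
    · ring
    · rw [le_div_iff₀ (by linarith)]
      linarith
  · rw [h, Real.smoothTransition.zero_of_nonpos]
    · push_cast
      ring
    · apply div_nonpos_of_nonpos_of_nonneg _ (by linarith)
      push_cast
      linarith

theorem smoothStaircase_eventuallyEq {r t : ℝ} (hr : 0 < r) (h : r < |t - round t|) :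
    ∃ a, smoothStaircase r =ᶠ[𝓝 t] fun _ => a := by
  have h1 : ∀ m : ℤ, r < |t - m| := fun m => h.trans_le (round_le t m)
  have h2 : ⌊t⌋ + r < t := by
    have := h1 ⌊t⌋
    rw [abs_of_nonneg (by linarith [Int.floor_le t])] at this
    linarith
  have h3 : t < ⌊t⌋ + 1 - r := by
    have := h1 (⌊t⌋ + 1)
    push_cast at this
    rw [abs_of_neg (by linarith [Int.lt_floor_add_one t])] at this
    linarith
  refine ⟨⌊t⌋ + 1 / 2, ?_⟩
  filter_upwards [Ioo_mem_nhds h2 h3] with s hs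
  exact smoothStaircase_eq hr hs.1.le hs.2.le

/-- `round` jumps only at half-integers, and these lie inside the plateaus because `r < 1 / 2`; near
the integers `round` is locally constant. -/
theorem contDiff_smoothStaircase {r : ℝ} (hr : 0 < r) (hr2 : r < 1 / 2) :
    ContDiff ℝ ∞ (smoothStaircase r) := by
  refine contDiff_iff_contDiffAt.2 fun t => ?_
  by_cases h : r < |t - round t|
  · obtain ⟨a, ha⟩ := smoothStaircase_eventuallyEq hr h
    exact contDiffAt_const.congr_of_eventuallyEq ha
  · have hlt := abs_lt.1 ((not_lt.1 h).trans_lt hr2)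
    have hev : smoothStaircase r =ᶠ[𝓝 t] fun s =>
        (round t : ℝ) + (Real.smoothTransition ((s - round t + r) / (2 * r)) - 1 / 2) := by
      filter_upwards [Ioo_mem_nhds (show (round t : ℝ) - 1 / 2 < t by linarith)
        (show t < (round t : ℝ) + 1 / 2 by linarith)] with s hs
      have : round s = round t := by
        rw [round_eq, Int.floor_eq_iff]
        constructor <;> linarith [hs.1, hs.2]
      rw [smoothStaircase, this]
    refine ContDiffAt.congr_of_eventuallyEq ?_ hev
    have : ContDiff ℝ ∞ fun s : ℝ => (s - round t + r) / (2 * r) := by fun_prop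
    have h2 : ContDiff ℝ ∞ fun s : ℝ => Real.smoothTransition ((s - round t + r) / (2 * r)) :=
      Real.smoothTransition.contDiff.comp this
    exact (contDiff_const.add (h2.sub contDiff_const)).contDiffAt

/-- The transition is monotone and equals `1 / 2` at its centre, so the staircase and `t` lie on the
same side of `round t`, each within `1 / 2` of it. -/
theorem abs_smoothStaircase_sub_le {r : ℝ} (hr : 0 < r) (t : ℝ) :
    |smoothStaircase r t - t| ≤ 1 / 2 := by
  have ha := abs_le.1 (abs_sub_round t)
  have hhalf : Real.smoothTransition (1 / 2) = 1 / 2 := by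
    have := Real.smoothTransition.pos_denom (1 / 2)
    rw [Real.smoothTransition]
    norm_num at this ⊢
    field_simp
    norm_num
  have h0 := Real.smoothTransition.nonneg ((t - round t + r) / (2 * r))
  have h1 := Real.smoothTransition.le_one ((t - round t + r) / (2 * r))
  unfold smoothStaircase
  rw [abs_le]
  rcases le_total 0 (t - round t) with h | h
  · have : Real.smoothTransition (1 / 2) ≤ Real.smoothTransition ((t - round t + r) / (2 * r)) :=
      Real.smoothTransition.monotone (by rw [le_div_iff₀ (by linarith)]; linarith)
    constructor <;> linarith
  · have : Real.smoothTransition ((t - round t + r) / (2 * r)) ≤ Real.smoothTransition (1 / 2) :=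
      Real.smoothTransition.monotone (by rw [div_le_iff₀ (by linarith)]; linarith)
    constructor <;> linarith

/-! ### Lattice translates avoiding a set of small volume. -/

/-- Blichfeldt's pigeonhole: if every `c` were congruent mod `ℤⁿ` to a point of `K`, the lattice
translates of `K` would cover the unit cube, forcing `volume K ≥ 1`. -/
theorem exists_translate_int_lattice_avoiding {ι : Type*} [Fintype ι] {K : Set (ι → ℝ)}
    (hK : volume K < 1) : ∃ c : ι → ℝ, ∀ x ∈ K, ∃ i, ∀ m : ℤ, x i - c i ≠ m := by
  classical
  by_contra! hc
  let b := Pi.basisFun ℝ ι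
  have hD : volume (ZSpan.fundamentalDomain b) = 1 := by
    rw [ZSpan.fundamentalDomain_pi_basisFun, volume_pi, Measure.pi_pi]
    simp
  have hfd := ZSpan.isAddFundamentalDomain' b volume
  have : VAddInvariantMeasure (Submodule.span ℤ (Set.range b)).toAddSubgroup (ι → ℝ) volume :=
    inferInstance
  have : Countable (Submodule.span ℤ (Set.range b)).toAddSubgroup :=
    inferInstanceAs (Countable (Submodule.span ℤ (Set.range b)))
  have hsub : ZSpan.fundamentalDomain b ⊆
      ⋃ g : (Submodule.span ℤ (Set.range b)).toAddSubgroup, (g +ᵥ K) ∩ ZSpan.fundamentalDomain b := by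
    intro c hcD
    obtain ⟨x, hx, hxc⟩ := hc c
    choose m hm using hxc
    have hmem : c - x ∈ Submodule.span ℤ (Set.range b) := by
      rw [Module.Basis.mem_span_iff_repr_mem]
      intro i
      refine ⟨-m i, ?_⟩
      simp [b, ← hm i]
    refine Set.mem_iUnion.2 ⟨⟨c - x, hmem⟩, ⟨x, hx, ?_⟩, hcD⟩
    simp [AddSubgroup.vadd_def]
  have : (1 : ℝ≥0∞) ≤ volume K := by
    rw [← hD, hfd.measure_eq_tsum K]
    exact (measure_mono hsub).trans (measure_iUnion_le _)
  exact absurd hK (not_lt.2 this)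

theorem exists_uniform_translate_int_lattice_avoiding {ι : Type*} [Fintype ι] {K : Set (ι → ℝ)}
    (hK : IsCompact K) (hvol : volume K < 1) :
    ∃ (c : ι → ℝ) (r : ℝ), 0 < r ∧ r < 1 / 2 ∧
      ∀ x ∈ K, ∃ i, r < |x i - c i - round (x i - c i)| := by
  obtain ⟨c, hc⟩ := exists_translate_int_lattice_avoiding hvol
  rcases K.eq_empty_or_nonempty with rfl | hne
  · exact ⟨c, 1 / 4, by norm_num, by norm_num, by simp⟩
  -- The norm on `UnitAddCircle` is the distance to the nearest integer, so `g` is a continuous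
  -- gauge vanishing exactly on the translated lattice; its minimum on `K` is positive.
  let g : (ι → ℝ) → ℝ := fun x => ∑ i, ‖((x i - c i : ℝ) : UnitAddCircle)‖
  have hg : Continuous g := by
    refine continuous_finsetSum _ fun i _ => ?_
    exact continuous_norm.comp ((AddCircle.continuous_mk' 1).comp (by fun_prop))
  obtain ⟨x₀, hx₀, hmin⟩ := hK.exists_isMinOn hne hg.continuousOn
  have hpos : 0 < g x₀ := by
    obtain ⟨i, hi⟩ := hc x₀ hx₀
    refine Finset.sum_pos' (fun _ _ => norm_nonneg _) ⟨i, Finset.mem_univ i, ?_⟩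
    rw [UnitAddCircle.norm_eq]
    exact abs_pos.2 (sub_ne_zero.2 (hi _))
  set N : ℝ := (Fintype.card ι : ℝ) with hN
  have hN0 : 0 ≤ N := Nat.cast_nonneg _
  -- If all `N` distances were at most `g x₀ / (N + 1)`, their sum would fall below the minimum `g
  -- x₀`.
  refine ⟨c, min (1 / 4) (g x₀ / (N + 1)), by positivity,
    (min_le_left _ _).trans_lt (by norm_num), fun x hx => ?_⟩
  by_contra! h
  have h1 : g x ≤ N * (g x₀ / (N + 1)) := by
    have : g x ≤ ∑ _i : ι, g x₀ / (N + 1) := Finset.sum_le_sum fun i _ => by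
      rw [UnitAddCircle.norm_eq]
      exact (h i).trans (min_le_right _ _)
    simpa [hN] using this
  have h2 : g x₀ ≤ g x := hmin hx
  have h3 : N * (g x₀ / (N + 1)) < g x₀ := by
    rw [mul_div_assoc', div_lt_iff₀ (by linarith)]
    linarith
  linarith

/-! ### The bracket as a Jacobian, and the volume of the image. -/

namespace VolumeForm
variable {n : ℕ} {M : Type*} [TopologicalSpace M] [ChartedSpace (EuclideanSpace ℝ (Fin n)) M]

theorem contDiffAt_toLp_comp_symm {F : Fin n → M → ℝ}
    (hF : ∀ i, ContMDiff (𝓡 n) 𝓘(ℝ, ℝ) ∞ (F i))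
    {e : OpenPartialHomeomorph M (EuclideanSpace ℝ (Fin n))}
    (he : e ∈ IsManifold.maximalAtlas (𝓡 n) ∞ M) {y : EuclideanSpace ℝ (Fin n)}
    (hy : y ∈ e.target) :
    ContDiffAt ℝ ∞ (fun z => WithLp.toLp 2 fun i => F i (e.symm z)) y := by
  rw [contDiffAt_piLp]
  intro i
  exact (ContMDiffAt.comp y (hF i (e.symm y))
    (contMDiffAt_symm_of_mem_maximalAtlas he hy)).contDiffAt

/-- This is `dF₁ ∧ … ∧ dFₙ = {F₁, …, Fₙ} Ω` evaluated on the coordinate frame of the chart, by the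
chain rule. -/
theorem det_fderiv_toLp_comp_symm (Ω : VolumeForm n M) {F : Fin n → M → ℝ}
    (hF : ∀ i, ContMDiff (𝓡 n) 𝓘(ℝ, ℝ) ∞ (F i))
    {e : OpenPartialHomeomorph M (EuclideanSpace ℝ (Fin n))}
    (he : e ∈ IsManifold.maximalAtlas (𝓡 n) ∞ M) {y : EuclideanSpace ℝ (Fin n)}
    (hy : y ∈ e.target) :
    (fderiv ℝ (fun z => WithLp.toLp 2 fun i => F i (e.symm z)) y).det =
      Ω.bracket F (e.symm y) * formCoeff Ω.toFun e y := by
  have h1 := ((Ω.bracket_eq_iff F _).1 rfl (e.symm y))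
  have h2 := congrArg (fun η => η fun i =>
    mfderiv (𝓡 n) (𝓡 n) e.symm y (EuclideanSpace.basisFun (Fin n) ℝ i)) h1
  rw [AlternatingMap.smul_apply, smul_eq_mul] at h2
  refine Eq.trans ?_ h2.symm
  rw [wedgeDiff_apply, ContinuousLinearMap.det,
    ← LinearMap.det_toMatrix (EuclideanSpace.basisFun (Fin n) ℝ).toBasis]
  congr 1
  ext i j
  have hd := (contDiffAt_toLp_comp_symm hF he hy).differentiableAt (by simp)
  have a1 : MDifferentiableAt (𝓡 n) (𝓡 n) e.symm y :=
    (contMDiffAt_symm_of_mem_maximalAtlas he hy).mdifferentiableAt (by simp)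
  have a2 : MDifferentiableAt (𝓡 n) 𝓘(ℝ, ℝ) (F i) (e.symm y) :=
    (hF i _).mdifferentiableAt (by simp)
  have h3 := mfderiv_comp y a2 a1
  rw [mfderiv_eq_fderiv] at h3
  have h4 := hasFDerivWithinAt_euclidean.1 (hd.hasFDerivAt.hasFDerivWithinAt (s := Set.univ)) i
  have h5 := (hasFDerivWithinAt_univ.1 h4).fderiv
  have h6 := congrArg (fun A : EuclideanSpace ℝ (Fin n) →L[ℝ] ℝ =>
    A (EuclideanSpace.basisFun (Fin n) ℝ j)) (h5.symm.trans h3)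
  simp only [LinearMap.toMatrix_apply, Matrix.of_apply, OrthonormalBasis.coe_toBasis]
  exact h6

/-- By the change of charts formula a zero would pass to the preferred chart at the point, where `Ω`
is evaluated on a basis of the tangent space. -/
theorem formCoeff_ne_zero [IsManifold (𝓡 n) ∞ M] (Ω : VolumeForm n M)
    {e : OpenPartialHomeomorph M (EuclideanSpace ℝ (Fin n))}
    (he : e ∈ IsManifold.maximalAtlas (𝓡 n) ∞ M) {y : EuclideanSpace ℝ (Fin n)}
    (hy : y ∈ e.target) : formCoeff Ω.toFun e y ≠ 0 := by
  intro h0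
  set x := e.symm y with hx
  let e' := chartAt (EuclideanSpace ℝ (Fin n)) x
  have hxe : x ∈ e'.source := mem_chart_source _ _
  have hye : e' x ∈ e'.target := e'.map_source hxe
  have hxx : e'.symm (e' x) = x := e'.left_inv hxe
  have hch := (Ω.formCoeff_change he (IsManifold.chart_mem_maximalAtlas x) hye
    (by rw [hxx]; exact e.map_target hy)).2
  have hpt : (e ∘ e'.symm) (e' x) = y := by
    simp only [Function.comp_apply, hxx]
    exact e.right_inv hy
  rw [hpt, h0, mul_zero] at hch
  have hbij := ((mdifferentiable_of_mem_atlas (I := 𝓡 n) (chart_mem_atlas _ x)).symm).mfderiv_bijective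
    (show e' x ∈ e'.symm.source from hye)
  let A : EuclideanSpace ℝ (Fin n) ≃ₗ[ℝ] TangentSpace (𝓡 n) (e'.symm (e' x)) :=
    LinearEquiv.ofBijective (mfderiv (𝓡 n) (𝓡 n) e'.symm (e' x)).toLinearMap hbij
  have hne := (AlternatingMap.map_basis_ne_zero_iff
    ((EuclideanSpace.basisFun (Fin n) ℝ).toBasis.map A) (Ω.toFun (e'.symm (e' x)))).2 (Ω.ne_zero' _)
  apply hne
  rw [← hch]
  unfold formCoeff
  congr 1

theorem continuous_bracket [IsManifold (𝓡 n) ∞ M] (Ω : VolumeForm n M) {F : Fin n → M → ℝ}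
    (hF : ∀ i, ContMDiff (𝓡 n) 𝓘(ℝ, ℝ) ∞ (F i)) : Continuous (Ω.bracket F) := by
  refine continuous_iff_continuousAt.2 fun x => ?_
  let e := chartAt (EuclideanSpace ℝ (Fin n)) x
  have he : e ∈ IsManifold.maximalAtlas (𝓡 n) ∞ M := IsManifold.chart_mem_maximalAtlas x
  have hx : x ∈ e.source := mem_chart_source _ _
  have hy := e.map_source hx
  have h1 : ContinuousAt (fun y => (fderiv ℝ (fun z => WithLp.toLp 2 fun i => F i (e.symm z)) y).det)
      (e x) :=
    ContinuousLinearMap.continuous_det.continuousAt.comp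
      ((contDiffAt_toLp_comp_symm hF he hy).continuousAt_fderiv (by simp))
  have h2 : ContinuousAt (formCoeff Ω.toFun e) (e x) :=
    (Ω.smooth' e he).continuousOn.continuousAt (e.open_target.mem_nhds hy)
  have h3 := (h1.div h2 (Ω.formCoeff_ne_zero he hy)).comp (e.continuousAt hx)
  refine h3.congr ?_
  filter_upwards [e.open_source.mem_nhds hx] with z hz
  have hz' := e.map_source hz
  simp only [Function.comp_apply, Pi.div_apply]
  rw [Ω.det_fderiv_toLp_comp_symm hF he hz', mul_div_cancel_right₀ _ (Ω.formCoeff_ne_zero he hz'),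
    e.left_inv hz]

/-- The area inequality in one chart: the Jacobian is the bracket times the density of `Ω`, so its
integral is the integral of the bracket against `Ω`. Overlaps in the image only help. -/
theorem volume_image_le_of_subset_source [IsManifold (𝓡 n) ∞ M] [MeasurableSpace M] [BorelSpace M]
    (Ω : VolumeForm n M) {F : Fin n → M → ℝ} (hF : ∀ i, ContMDiff (𝓡 n) 𝓘(ℝ, ℝ) ∞ (F i))
    {e : OpenPartialHomeomorph M (EuclideanSpace ℝ (Fin n))}
    (he : e ∈ IsManifold.maximalAtlas (𝓡 n) ∞ M) {s : Set M} (hs : MeasurableSet s)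
    (hse : s ⊆ e.source) :
    volume ((fun x => WithLp.toLp 2 fun i => F i x) '' s) ≤
      ∫⁻ x in s, ‖Ω.bracket F x‖ₑ ∂Ω.measure := by
  have hres : Ω.measure.restrict s = (Ω.chartMeasure e).restrict s := by
    ext t ht
    rw [Measure.restrict_apply ht, Measure.restrict_apply ht,
      Ω.measure_apply_of_subset he (ht.inter hs) (Set.inter_subset_right.trans hse)]
  have hmeas : Measurable (s.indicator fun x => ‖Ω.bracket F x‖ₑ) :=
    (Ω.continuous_bracket hF).measurable.enorm.indicator hs
  have hsymm : AEMeasurable e.symm (volume.restrict e.target) :=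
    e.continuousOn_symm.aemeasurable e.open_target.measurableSet
  have hcoeff : AEMeasurable (fun y => ‖formCoeff Ω.toFun e y‖ₑ) (volume.restrict e.target) :=
    ((Ω.smooth' e he).continuousOn.aemeasurable e.open_target.measurableSet).enorm
  have hT : MeasurableSet (e.target ∩ e.symm ⁻¹' s) := by
    have h1 : Measurable fun z : e.target => e.symm z :=
      (continuousOn_iff_continuous_domRestrict.1 e.continuousOn_symm).measurable
    have := e.open_target.measurableSet.subtype_image (h1 hs)
    rwa [show (Subtype.val '' ((fun z : e.target => e.symm z) ⁻¹' s)) =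
      e.target ∩ e.symm ⁻¹' s from Subtype.image_preimage_coe e.target (e.symm ⁻¹' s)] at this
  rw [hres, ← lintegral_indicator hs, chartMeasure, lintegral_map' hmeas.aemeasurable
    (hsymm.mono_ac (withDensity_absolutelyContinuous _ _))]
  refine le_trans ?_
    (lintegral_withDensity_eq_lintegral_mul₀ hcoeff (hmeas.comp_aemeasurable hsymm)).ge
  have him : (fun x => WithLp.toLp 2 fun i => F i x) '' s =
      (fun z => WithLp.toLp 2 fun i => F i (e.symm z)) '' (e.target ∩ e.symm ⁻¹' s) := by
    ext w
    constructor
    · rintro ⟨x, hx, rfl⟩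
      refine ⟨e x, ⟨e.map_source (hse hx), ?_⟩, ?_⟩
      · simpa [e.left_inv (hse hx)] using hx
      · simp [e.left_inv (hse hx)]
    · rintro ⟨z, hz, rfl⟩
      exact ⟨e.symm z, hz.2, rfl⟩
  rw [him]
  refine (addHaar_image_le_lintegral_abs_det_fderiv volume hT fun y hy =>
    ((contDiffAt_toLp_comp_symm hF he hy.1).differentiableAt
      (by simp)).hasFDerivAt.hasFDerivWithinAt).trans ?_
  refine le_trans (le_of_eq ?_) (lintegral_mono_set
    (Set.inter_subset_left : e.target ∩ e.symm ⁻¹' s ⊆ e.target))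
  refine setLIntegral_congr_fun hT fun y hy => ?_
  simp only [Pi.mul_apply, Function.comp_apply]
  rw [Ω.det_fderiv_toLp_comp_symm hF he hy.1, Set.indicator_of_mem (show e.symm y ∈ s from hy.2),
    ← Real.enorm_eq_ofReal_abs,
    enorm_mul, mul_comm]

theorem volume_range_le_normL1_bracket [IsManifold (𝓡 n) ∞ M] [CompactSpace M] [MeasurableSpace M]
    [BorelSpace M] (Ω : VolumeForm n M) {F : Fin n → M → ℝ}
    (hF : ∀ i, ContMDiff (𝓡 n) 𝓘(ℝ, ℝ) ∞ (F i)) :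
    volume (Set.range fun x i => F i x) ≤ Ω.normL1 (Ω.bracket F) := by
  classical
  -- Induction on a finite cover by charts, splitting off the part of `s` in one chart at a time, so
  -- that the pieces are disjoint and no mass is counted twice.
  have key : ∀ (t : Finset M) (s : Set M), MeasurableSet s →
      s ⊆ ⋃ x ∈ t, (chartAt (EuclideanSpace ℝ (Fin n)) x).source →
      volume ((fun x => WithLp.toLp 2 fun i => F i x) '' s) ≤
        ∫⁻ x in s, ‖Ω.bracket F x‖ₑ ∂Ω.measure := by
    intro t
    induction t using Finset.induction_on with
    | empty =>
      intro s _ h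
      have : s = ∅ := by simpa using h
      simp [this]
    | insert a t _ ih =>
      intro s hs h
      have hsrc := (chartAt (EuclideanSpace ℝ (Fin n)) a).open_source.measurableSet
      rw [← lintegral_inter_add_sdiff _ s hsrc]
      refine le_trans ?_ (add_le_add (Ω.volume_image_le_of_subset_source hF
        (IsManifold.chart_mem_maximalAtlas a) (hs.inter hsrc) Set.inter_subset_right)
        (ih _ (hs.diff hsrc) ?_))
      · refine (measure_mono ?_).trans (measure_union_le _ _)
        rw [← Set.image_union, Set.inter_union_sdiff]
      · intro x hx
        have := h hx.1
        rw [Finset.set_biUnion_insert] at this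
        exact this.resolve_left hx.2
  obtain ⟨t, -, ht⟩ := isCompact_univ.elim_nhds_subcover
    (fun x : M => (chartAt (EuclideanSpace ℝ (Fin n)) x).source)
    fun x _ => (chartAt (EuclideanSpace ℝ (Fin n)) x).open_source.mem_nhds (mem_chart_source _ x)
  have h := key t Set.univ MeasurableSet.univ ht
  rw [Measure.restrict_univ, Set.image_univ] at h
  refine le_trans (le_of_eq ?_) h
  rw [← (PiLp.volume_preserving_ofLp (Fin n)).measure_preimage_equiv
    (f := (MeasurableEquiv.toLp 2 (Fin n → ℝ)).symm)]
  congr 1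
  ext w
  constructor
  · rintro ⟨x, hx⟩
    exact ⟨x, congrArg (WithLp.toLp 2) hx⟩
  · rintro ⟨x, rfl⟩
    exact ⟨x, rfl⟩

end VolumeForm

/-! ### Perturbation when the image has volume below `Lⁿ`. -/

theorem uniformNorm_le_ofReal {X : Type*} {f : X → ℝ} {a : ℝ} (h : ∀ x, |f x| ≤ a) :
    uniformNorm f ≤ ENNReal.ofReal a :=
  iSup_le fun x => by
    rw [Real.enorm_eq_ofReal_abs]
    exact ENNReal.ofReal_le_ofReal (h x)

theorem exists_scaled_translate_int_lattice_avoiding {ι : Type*} [Fintype ι] {K : Set (ι → ℝ)}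
    (hK : IsCompact K) {L : ℝ} (hL : 0 < L)
    (hvol : volume K < ENNReal.ofReal (L ^ Fintype.card ι)) :
    ∃ (c : ι → ℝ) (r : ℝ), 0 < r ∧ r < 1 / 2 ∧
      ∀ x ∈ K, ∃ i, r < |L⁻¹ * x i - c i - round (L⁻¹ * x i - c i)| := by
  have hscaled : volume ((fun x => L⁻¹ • x) '' K) < 1 := by
    rw [Set.image_smul, Measure.addHaar_smul, Module.finrank_fintype_fun_eq_card, inv_pow,
      abs_of_pos (by positivity), ENNReal.ofReal_inv_of_pos (by positivity), mul_comm,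
      ← div_eq_mul_inv]
    refine ENNReal.div_lt_of_lt_mul ?_
    rwa [one_mul]
  obtain ⟨c, r, hr, hr2, h⟩ := exists_uniform_translate_int_lattice_avoiding
    (hK.image (continuous_const_smul L⁻¹)) hscaled
  exact ⟨c, r, hr, hr2, fun x hx => h _ (Set.mem_image_of_mem _ hx)⟩

namespace VolumeForm
variable {n : ℕ} {M : Type*} [TopologicalSpace M] [ChartedSpace (EuclideanSpace ℝ (Fin n)) M]

theorem bracket_eq_zero_of_eventuallyEq_const (Ω : VolumeForm n M) {F : Fin n → M → ℝ} {x : M}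
    (i : Fin n) (a : ℝ) (h : F i =ᶠ[𝓝 x] fun _ => a) : Ω.bracket F x = 0 := by
  rw [bracket, wedgeDiff_apply, Matrix.det_eq_zero_of_row_eq_zero i, zero_div]
  intro j
  have : mvfderiv (𝓡 n) (F i) x = 0 := by
    rw [mvfderiv, h.mfderiv_eq]
    rw [mfderiv_const]
    exact ContinuousLinearMap.comp_zero _
  simp [this]

/-- Where the bracket is nonzero the derivative in a chart is surjective, so the image contains a
neighbourhood of the value there. This settles `ε = 0`. -/
theorem volume_range_pos_of_bracket_ne_zero [IsManifold (𝓡 n) ∞ M] (Ω : VolumeForm n M)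
    {F : Fin n → M → ℝ} (hF : ∀ i, ContMDiff (𝓡 n) 𝓘(ℝ, ℝ) ∞ (F i)) {x : M}
    (hx : Ω.bracket F x ≠ 0) : 0 < volume (Set.range fun x i => F i x) := by
  let e := chartAt (EuclideanSpace ℝ (Fin n)) x
  have he : e ∈ IsManifold.maximalAtlas (𝓡 n) ∞ M := IsManifold.chart_mem_maximalAtlas x
  have hxe : x ∈ e.source := mem_chart_source _ x
  have hy := e.map_source hxe
  have hdet := Ω.det_fderiv_toLp_comp_symm hF he hy
  rw [e.left_inv hxe] at hdet
  have hne : (fderiv ℝ (fun z => WithLp.toLp 2 fun i => F i (e.symm z)) (e x)).det ≠ 0 := by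
    rw [hdet]
    exact mul_ne_zero hx (Ω.formCoeff_ne_zero he hy)
  have hstrict := (contDiffAt_toLp_comp_symm hF he hy).hasStrictFDerivAt (by simp)
  have hmap := hstrict.map_nhds_eq_of_surj
    (LinearMap.range_eq_top.2
      ((Module.End.isUnit_iff _).1 ((LinearMap.isUnit_iff_isUnit_det _).2 hne.isUnit)).surjective)
  have hmem : Set.range (fun x => WithLp.toLp 2 fun i => F i x) ∈
      𝓝 (WithLp.toLp 2 fun i => F i (e.symm (e x))) := by
    rw [← hmap]
    exact Filter.mem_map.2 (Filter.univ_mem' fun z => ⟨e.symm z, rfl⟩)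
  have hcont : Continuous (WithLp.toLp 2 : (Fin n → ℝ) → EuclideanSpace ℝ (Fin n)) :=
    PiLp.continuous_toLp 2 _
  refine Measure.measure_pos_of_mem_nhds volume (x := fun i => F i (e.symm (e x))) ?_
  filter_upwards [hcont.continuousAt.preimage_mem_nhds hmem]
  rintro w ⟨z, hz⟩
  exact ⟨z, congrArg WithLp.ofLp hz⟩

theorem exists_bracket_eq_zero_of_volume_range_lt (Ω : VolumeForm n M) [CompactSpace M]
    {F : Fin n → M → ℝ} (hF : ∀ i, ContMDiff (𝓡 n) 𝓘(ℝ, ℝ) ∞ (F i)) {L : ℝ} (hL : 0 < L)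
    (hvol : volume (Set.range fun x i => F i x) < ENNReal.ofReal (L ^ n)) :
    ∃ F' : Fin n → M → ℝ, (∀ i, ContMDiff (𝓡 n) 𝓘(ℝ, ℝ) ∞ (F' i)) ∧
      (∀ i, uniformNorm (fun x => F i x - F' i x) ≤ ENNReal.ofReal (L / 2)) ∧
      ∀ x, Ω.bracket F' x = 0 := by
  have hcont : Continuous fun x i => F i x := continuous_pi fun i => (hF i).continuous
  obtain ⟨c, r, hr, hr2, hK⟩ := exists_scaled_translate_int_lattice_avoiding
    (isCompact_range hcont) hL (by rwa [Fintype.card_fin])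
  -- The staircase conjugated by `t ↦ L⁻¹ * t - c i`: its risers sit at the avoided lattice, and its
  -- error `1 / 2` becomes `L / 2`.
  refine ⟨fun i x => L * (smoothStaircase r (L⁻¹ * F i x - c i) + c i), fun i => ?_, fun i => ?_,
    fun x => ?_⟩
  · have hlin : ContDiff ℝ ∞ fun t : ℝ => L⁻¹ * t - c i := by fun_prop
    have : ContDiff ℝ ∞ fun t => L * (smoothStaircase r (L⁻¹ * t - c i) + c i) :=
      contDiff_const.mul (((contDiff_smoothStaircase hr hr2).comp hlin).add contDiff_const)
    exact this.contMDiff.comp (hF i)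
  · refine uniformNorm_le_ofReal fun x => ?_
    have h := abs_smoothStaircase_sub_le hr (L⁻¹ * F i x - c i)
    set t := L⁻¹ * F i x - c i with ht
    have hFx : F i x = L * (t + c i) := by
      rw [ht]
      field_simp
      ring
    rw [hFx, ← mul_sub, abs_mul, abs_of_pos hL, add_sub_add_right_eq_sub, abs_sub_comm]
    linarith [mul_le_mul_of_nonneg_left h hL.le]
  · obtain ⟨i, hi⟩ := hK _ (Set.mem_range_self x)
    obtain ⟨a, ha⟩ := smoothStaircase_eventuallyEq hr hi
    refine Ω.bracket_eq_zero_of_eventuallyEq_const i (L * (a + c i)) ?_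
    have hlim : ContinuousAt (fun z => L⁻¹ * F i z - c i) x :=
      (((hF i).continuous.const_mul _).sub continuous_const).continuousAt
    filter_upwards [hlim.eventually ha] with z hz
    rw [hz]

end VolumeForm

/-! ### Dimension one. -/

/-- A component is connected and compact, so its image is a closed interval, of length at most `2 *
δ`, and no point of it is further than `δ` from the midpoint. -/
theorem abs_sub_midpoint_connectedComponent_le {M : Type*} [TopologicalSpace M] [CompactSpace M]
    {f : M → ℝ} (hf : Continuous f) {δ : ℝ} (hδ : 0 ≤ δ)
    (hvol : volume (Set.range f) ≤ ENNReal.ofReal (2 * δ)) (x : M) :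
    |f x - (sInf (f '' connectedComponent x) + sSup (f '' connectedComponent x)) / 2| ≤ δ := by
  set a := sInf (f '' connectedComponent x)
  set b := sSup (f '' connectedComponent x)
  have hIcc : f '' connectedComponent x = Set.Icc a b :=
    eq_Icc_of_connected_compact (isConnected_connectedComponent.image f hf.continuousOn)
      (isClosed_connectedComponent.isCompact.image hf)
  have hx : f x ∈ Set.Icc a b := hIcc ▸ Set.mem_image_of_mem f mem_connectedComponent
  have hle : ENNReal.ofReal (b - a) ≤ ENNReal.ofReal (2 * δ) := by
    rw [← Real.volume_Icc, ← hIcc]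
    exact (measure_mono (Set.image_subset_range _ _)).trans hvol
  have := (ENNReal.ofReal_le_ofReal_iff (by positivity)).1 hle
  rw [abs_le]
  constructor <;> linarith [hx.1, hx.2]

theorem VolumeForm.exists_bracket_eq_zero_of_dim_one {M : Type*} [TopologicalSpace M]
    [CompactSpace M] [ChartedSpace (EuclideanSpace ℝ (Fin 1)) M] (Ω : VolumeForm 1 M)
    {F : Fin 1 → M → ℝ} (hF : ∀ i, ContMDiff (𝓡 1) 𝓘(ℝ, ℝ) ∞ (F i)) {δ : ℝ} (hδ : 0 ≤ δ)
    (hvol : volume (Set.range fun x i => F i x) ≤ ENNReal.ofReal (2 * δ)) :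
    ∃ F' : Fin 1 → M → ℝ, (∀ i, ContMDiff (𝓡 1) 𝓘(ℝ, ℝ) ∞ (F' i)) ∧
      (∀ i, uniformNorm (fun x => F i x - F' i x) ≤ ENNReal.ofReal δ) ∧
      ∀ x, Ω.bracket F' x = 0 := by
  have : LocallyConnectedSpace M := ChartedSpace.locallyConnectedSpace (EuclideanSpace ℝ (Fin 1)) M
  have hvol1 : ∀ i, volume (Set.range (F i)) ≤ ENNReal.ofReal (2 * δ) := fun i => by
    rw [← (volume_preserving_funUnique (Fin 1) ℝ).measure_preimage_equiv]
    refine le_trans (le_of_eq (congrArg _ ?_)) hvol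
    ext w
    simp only [Set.mem_preimage, Set.mem_range, MeasurableEquiv.funUnique_apply]
    refine exists_congr fun x => ?_
    rw [funext_iff, Fin.forall_fin_one, Subsingleton.elim i 0]
    rfl
  let m : Fin 1 → M → ℝ := fun i x =>
    (sInf (F i '' connectedComponent x) + sSup (F i '' connectedComponent x)) / 2
  -- Components of a manifold are open, so the midpoint function is locally constant, hence smooth
  -- with zero differential.
  have hconst : ∀ i x, m i =ᶠ[𝓝 x] fun _ => m i x := fun i x => by
    filter_upwards [isOpen_connectedComponent.mem_nhds (mem_connectedComponent (x := x))] with z hz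
    simp only [m, connectedComponent_eq hz]
  refine ⟨m, fun i x => ?_, fun i => ?_, fun x => ?_⟩
  · exact contMDiffAt_const.congr_of_eventuallyEq (hconst i x)
  · exact uniformNorm_le_ofReal
      (abs_sub_midpoint_connectedComponent_le (hF i).continuous hδ (hvol1 i))
  · exact Ω.bracket_eq_zero_of_eventuallyEq_const 0 _ (hconst 0 x)

end

theorem theorem1 (n : ℕ) (hn : 1 ≤ n) (M : Type*) [TopologicalSpace M] [T2Space M] [CompactSpace M]
    [ChartedSpace (EuclideanSpace ℝ (Fin n)) M] [IsManifold (𝓡 n) ∞ M]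
    [MeasurableSpace M] [BorelSpace M]
    (Ω : VolumeForm n M) (ε : ℝ) (hε : 0 ≤ ε)
    (F : Fin n → M → ℝ) (hF : ∀ i, ContMDiff (𝓡 n) 𝓘(ℝ, ℝ) ∞ (F i))
    (hL1 : Ω.normL1 (Ω.bracket F) ≤ ENNReal.ofReal (2 * ε)) :
    ∃ F' : Fin n → M → ℝ, (∀ i, ContMDiff (𝓡 n) 𝓘(ℝ, ℝ) ∞ (F' i)) ∧
      (∀ i, uniformNorm (fun x => F i x - F' i x) ≤ ENNReal.ofReal (ε ^ (1 / (n : ℝ)))) ∧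
      ∀ x, Ω.bracket F' x = 0 := by
  have hvol := (Ω.volume_range_le_normL1_bracket hF).trans hL1
  rcases hn.eq_or_lt with rfl | hn2
  · rw [Nat.cast_one, div_one, Real.rpow_one]
    exact Ω.exists_bracket_eq_zero_of_dim_one hF hε hvol
  rcases hε.eq_or_lt with rfl | hpos
  · refine ⟨F, hF, fun i => uniformNorm_le_ofReal fun x => ?_, fun x => ?_⟩
    · rw [sub_self, abs_zero]
      positivity
    · by_contra hx
      have := (Ω.volume_range_pos_of_bracket_ne_zero hF hx).trans_le hvol
      simp at this
  · have hs : 0 < ε ^ (1 / (n : ℝ)) := Real.rpow_pos_of_pos hpos _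
    have hsn : (ε ^ (1 / (n : ℝ))) ^ n = ε := by
      rw [one_div, Real.rpow_inv_natCast_pow hε (by omega)]
    -- The strict inequality `2 < 2 ^ n` is where `n ≥ 2` is needed.
    have hLn : 2 * ε < (2 * ε ^ (1 / (n : ℝ))) ^ n := by
      rw [mul_pow, hsn]
      exact mul_lt_mul_of_pos_right (lt_self_pow₀ one_lt_two hn2) hpos
    obtain ⟨F', h1, h2, h3⟩ := Ω.exists_bracket_eq_zero_of_volume_range_lt hF
      (L := 2 * ε ^ (1 / (n : ℝ))) (by positivity)
      (hvol.trans_lt ((ENNReal.ofReal_lt_ofReal_iff (by positivity)).2 hLn))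
    refine ⟨F', h1, fun i => (h2 i).trans_eq ?_, h3⟩
    rw [mul_div_cancel_left₀ _ two_ne_zero]
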